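/- Let $q$ be a prime power and let $X$ be the Hermitian curve $y^q+y=x^{q+1}$ over $\mathbb{F}_{q^2}$, with $P_\infty$ the point at infinity and $P_0=(0,0)$ the origin. For a divisor $G$ on $X$ defined over $\mathbb{F}_{q^2}$ let $L(G)$ consist of $0$ and all nonzero $f\in\mathbb{F}_{q^2}(X)$ with $(f)+G\ge 0$. For integers $a,b$ let $M_{P_0}(a,b)$ be the set of pairs $(f,g)$ of rational functions on $X$ such that $$fg\in L(aP_\infty+bP_0)\setminus L(aP_\infty+(b-1)P_0),\qquad f\in L(aP_\infty+bP_0),\qquad g\in L((a+b)P_0),$$ and put $$m_{P_0}(a,b)=\#\{\,-a\le j\le b+1 : \exists (f,g)\in M_{P_0}(a,b+1)\text{ with }\operatorname{ord}_{P_0}(f)=-j\,\}.$$ Let $D=P_1+\cdots+P_n$ be a sum of pairwise distinct $\mathbb{F}_{q^2}$-rational points of $X$. For integers $a,b$ such that $\operatorname{supp}(D)$ is disjoint from $\operatorname{supp}(aP_\infty+bP_0)$, let $C(a,b)\subseteq\mathbb{F}_{q^2}^n$ be the image of $L(aP_\infty+bP_0)$ under $f\mapsto(f(P_1),\dots,f(P_n))$.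 **Theorem.** Let $a,b$ be integers such that $\operatorname{supp}(D)$ is disjoint from the supports of both $aP_\infty+bP_0$ and $aP_\infty+(b+1)P_0$, and let $\mathbf{c}=(c_1,\dots,c_n)\in\mathbb{F}_{q^2}^n$ be a vector that is orthogonal (for the bilinear form $\sum_i c_iv_i$) to $C(a,b)$ but not orthogonal to $C(a,b+1)$. Then the weight of $\mathbf{c}$, i.e. the number of its nonzero coordinates, is at least $m_{P_0}(a,b)$. -/

import Mathlib

open Polynomial

noncomputable section

/-! ### Places of a function field, divisors, Riemann-Roch spaces -/

namespace FunctionField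

/-- A place of the function field `K / F`: a discrete valuation ring of `K / F`, i.e. a valuation
ring `F ⊆ O ⊆ K` of `K` that is discrete (in particular `O ≠ K`). When `K` is the function field of
a smooth projective curve over `F`, the places are the closed points of the curve, `O` being the
local ring of the point. -/
@[ext]
structure Place (F K : Type*) [Field F] [Field K] [Algebra F K] where
  /-- the valuation ring, i.e. the local ring of the point -/
  ring : ValuationSubring K
  algebraMap_mem : ∀ c : F, algebraMap F K c ∈ ring
  discrete : IsDiscreteValuationRing ring

attribute [instance] Place.discrete

variable {F K : Type*} [Field F] [Field K] [Algebra F K]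

namespace Place

/-- The order of vanishing at `P` of an element of the local ring
(junk value `0` for the zero function). -/
def ordNat (P : Place F K) (f : P.ring) : ℕ :=
  (IsDiscreteValuationRing.addVal P.ring f).toNat

open Classical in
/-- The order `ord_P f ∈ ℤ` of a nonzero function `f` at `P`, negative at poles
(junk value `0` for `f = 0`). -/
def ord (P : Place F K) (f : K) : ℤ :=
  if h : f ∈ P.ring then (P.ordNat ⟨f, h⟩ : ℤ)
  else -(P.ordNat ⟨f⁻¹, (P.ring.mem_or_inv_mem f).resolve_left h⟩ : ℤ)

/-- `P` is a rational point, i.e. a place of degree one: its residue field is `F`. (The set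
`P.ring.nonunits` is the maximal ideal of the local ring.) -/
def IsRational (P : Place F K) : Prop :=
  ∀ f ∈ P.ring, ∃ c : F, f - algebraMap F K c ∈ P.ring.nonunits

/-- The value `f(P) ∈ F` of a function `f` regular at the rational point `P`: the unique constant
congruent to `f` modulo the maximal ideal of `P`. -/
def value (P : Place F K) (f : K) : F :=
  Classical.epsilon fun c : F => f - algebraMap F K c ∈ P.ring.nonunits

end Place

/-- Divisors are finitely supported integer-valued functions on places. The Riemann-Roch space
`L(G)` consists of the zero function and the functions `f ≠ 0` with `(f) + G ≥ 0`. -/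
def riemannRoch (G : Place F K →₀ ℤ) : Set K :=
  {f | f = 0 ∨ ∀ P : Place F K, 0 ≤ P.ord f + G P}

/-- The code `C(D, G)` for `D = P 1 + ⋯ + P n`: the image of the evaluation map on `L(G)`. -/
def agCode {n : ℕ} (P : Fin n → Place F K) (G : Place F K →₀ ℤ) : Set (Fin n → F) :=
  (fun f i => (P i).value f) '' riemannRoch G

end FunctionField

/-! ### The Hermitian curve `y ^ q + y = x ^ (q + 1)` -/

namespace Hermitian

open FunctionField

variable (q : ℕ) (F : Type*) [Field F]

/-- The polynomial `x ^ (q + 1) - (y ^ q + y)` in `F[y][x]`. -/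
def curvePoly : F[X][X] := X ^ (q + 1) - C (X ^ q + X)

/-- The affine coordinate ring `F[x, y] / (x ^ (q + 1) - (y ^ q + y))`. -/
abbrev CoordRing : Type _ := AdjoinRoot (curvePoly q F)

theorem curvePoly_monic : (curvePoly q F).Monic :=
  monic_X_pow_sub_C _ (Nat.succ_ne_zero q)

theorem curvePoly_natDegree : (curvePoly q F).natDegree = q + 1 :=
  natDegree_X_pow_sub_C

theorem ofY_injective : Function.Injective (AdjoinRoot.of (curvePoly q F)) := by
  refine AdjoinRoot.of.injective_of_degree_ne_zero ?_
  rw [degree_eq_natDegree (curvePoly_monic q F).ne_zero, curvePoly_natDegree]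
  exact_mod_cast Nat.succ_ne_zero q

theorem curvePoly_irreducible [hq : Fact (IsPrimePow q)] : Irreducible (curvePoly q F) := by
  have h2 : 2 ≤ q := hq.out.two_le
  have hprime : (Ideal.span {(X : F[X])}).IsPrime :=
    (Ideal.span_singleton_prime X_ne_zero).2 prime_X
  refine irreducible_of_eisenstein_criterion hprime ?_ ?_ ?_ ?_ (curvePoly_monic q F).isPrimitive
  · rw [(curvePoly_monic q F).leadingCoeff]
    exact fun h => hprime.ne_top ((Ideal.eq_top_iff_one _).2 h)
  · intro n hn
    rw [degree_eq_natDegree (curvePoly_monic q F).ne_zero, curvePoly_natDegree] at hn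
    have hn' : n < q + 1 := by exact_mod_cast hn
    rw [curvePoly, coeff_sub, coeff_X_pow, if_neg hn'.ne, zero_sub, coeff_C]
    split_ifs
    · refine neg_mem (Ideal.mem_span_singleton.2 (dvd_add (dvd_pow_self _ (by omega)) dvd_rfl))
    · simp
  · rw [degree_eq_natDegree (curvePoly_monic q F).ne_zero, curvePoly_natDegree]
    exact_mod_cast Nat.succ_pos q
  · rw [Ideal.span_singleton_pow, Ideal.mem_span_singleton, X_pow_dvd_iff]
    intro h
    have h1 := h 1 (by norm_num)
    rw [curvePoly, coeff_sub, coeff_C_zero, coeff_X_pow, if_neg (by omega), zero_sub, coeff_neg,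
      coeff_add, coeff_X_pow, if_neg (by omega), coeff_X_one] at h1
    simp at h1

instance [Fact (IsPrimePow q)] : IsDomain (CoordRing q F) :=
  AdjoinRoot.isDomain_of_prime (curvePoly_irreducible q F).prime

/-- The function field of the Hermitian curve. -/
abbrev FunField [Fact (IsPrimePow q)] : Type _ := FractionRing (CoordRing q F)

/-- The coordinate function `x` in the coordinate ring. -/
def xR : CoordRing q F := AdjoinRoot.root (curvePoly q F)

/-- The coordinate function `y` in the coordinate ring. -/
def yR : CoordRing q F := AdjoinRoot.of (curvePoly q F) X

theorem xR_pow : (xR q F) ^ (q + 1) = (yR q F) ^ q + yR q F := by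
  have h : AdjoinRoot.mk (curvePoly q F) (X ^ (q + 1) - C (X ^ q + X)) = 0 := AdjoinRoot.mk_self
  rw [map_sub, sub_eq_zero, map_pow, AdjoinRoot.mk_X, AdjoinRoot.mk_C, map_add, map_pow] at h
  exact h

variable {q F}

/-- Substitution of a solution `(s, t)` of the equation of the curve for `(x, y)`. -/
def subst {A : Type*} [CommRing A] [Algebra F A] (s t : A) (h : t ^ q + t = s ^ (q + 1)) :
    CoordRing q F →ₐ[F] A :=
  AdjoinRoot.liftAlgHom (curvePoly q F) (aeval t) s (by
    rw [curvePoly, eval₂_sub, eval₂_X_pow, eval₂_C]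
    simp [h])

@[simp]
theorem subst_xR {A : Type*} [CommRing A] [Algebra F A] (s t : A) (h : t ^ q + t = s ^ (q + 1)) :
    subst (F := F) s t h (xR q F) = s := by
  simp [subst, xR]

@[simp]
theorem subst_yR {A : Type*} [CommRing A] [Algebra F A] (s t : A) (h : t ^ q + t = s ^ (q + 1)) :
    subst (F := F) s t h (yR q F) = t := by
  simp [subst, yR]

theorem hom_ext {A : Type*} [CommRing A] [Algebra F A] {φ ψ : CoordRing q F →ₐ[F] A}
    (hx : φ (xR q F) = ψ (xR q F)) (hy : φ (yR q F) = ψ (yR q F)) : φ = ψ := by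
  refine AdjoinRoot.algHom_ext' ?_ hx
  exact Polynomial.algHom_ext hy

variable (q F)

/-- Evaluation of polynomial functions at the origin `(0, 0)`. -/
def evalZero [hq : Fact (IsPrimePow q)] : CoordRing q F →ₐ[F] F :=
  subst 0 0 (by simp [hq.out.ne_zero])

section Valuation

variable [hq : Fact (IsPrimePow q)]

theorem evalZero_algebraMap (c : F) :
    evalZero q F (algebraMap F (CoordRing q F) c) = c := by
  rw [AlgHom.commutes, Algebra.algebraMap_self_apply]

/-- At the origin, `x` is a local parameter. -/
theorem xR_dvd_of_evalZero {u : CoordRing q F} (hu : evalZero q F u = 0) :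
    ∃ w, u * ((yR q F) ^ (q - 1) + 1) = xR q F * w := by
  set I : Ideal (CoordRing q F) := Ideal.span {xR q F, yR q F} with hI
  have hx : Ideal.Quotient.mkₐ F I (xR q F) = 0 :=
    Ideal.Quotient.eq_zero_iff_mem.2 (Ideal.subset_span (by simp))
  have hy : Ideal.Quotient.mkₐ F I (yR q F) = 0 :=
    Ideal.Quotient.eq_zero_iff_mem.2 (Ideal.subset_span (by simp))
  have hom : Ideal.Quotient.mkₐ F I = (Algebra.ofId F _).comp (evalZero q F) := by
    refine hom_ext ?_ ?_
    · rw [hx]; simp [evalZero]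
    · rw [hy]; simp [evalZero]
  have hmem : u ∈ I := by
    have h1 := DFunLike.congr_fun hom u
    rw [AlgHom.comp_apply, hu, map_zero] at h1
    exact Ideal.Quotient.eq_zero_iff_mem.1 h1
  obtain ⟨a, b, rfl⟩ := Ideal.mem_span_pair.1 hmem
  refine ⟨a * ((yR q F) ^ (q - 1) + 1) + b * (xR q F) ^ q, ?_⟩
  have hy' : yR q F * ((yR q F) ^ (q - 1) + 1) = xR q F * (xR q F) ^ q := by
    rw [mul_add, mul_one, mul_pow_sub_one hq.out.ne_zero, ← pow_succ', xR_pow]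
  linear_combination b * hy'

theorem evalZero_xR : evalZero q F (xR q F) = 0 := by simp [evalZero]

theorem evalZero_yR : evalZero q F (yR q F) = 0 := by simp [evalZero]

theorem evalZero_unit : evalZero q F ((yR q F) ^ (q - 1) + 1) = 1 := by
  have : q - 1 ≠ 0 := by have := hq.out.two_le; omega
  simp [evalZero_yR, this]

theorem xR_ne_zero : xR q F ≠ 0 := by
  intro h
  have h1 : (curvePoly q F) ∣ X := by
    rw [← AdjoinRoot.mk_eq_zero, AdjoinRoot.mk_X]; exact h
  have h2 := natDegree_le_of_dvd h1 X_ne_zero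
  rw [curvePoly_natDegree, natDegree_X] at h2
  have := hq.out.two_le
  omega

/-- Every nonzero polynomial function is, up to functions that do not vanish at the origin, a power
of `x`. -/
theorem exists_eq_pow_mul {u : CoordRing q F} (hu : u ≠ 0) :
    ∃ (k : ℕ) (a b : CoordRing q F), evalZero q F a ≠ 0 ∧ evalZero q F b ≠ 0 ∧
      u * b = (xR q F) ^ k * a := by
  have hM : (RingHom.ker (evalZero q F)).IsPrime := RingHom.ker_isPrime _
  let A := Localization.AtPrime (RingHom.ker (evalZero q F))
  have hle : (RingHom.ker (evalZero q F)).primeCompl ≤ nonZeroDivisors (CoordRing q F) :=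
    Ideal.primeCompl_le_nonZeroDivisors _
  have hdom : IsDomain A := IsLocalization.isDomain_localization hle
  have hinj : Function.Injective (algebraMap (CoordRing q F) A) :=
    IsLocalization.injective A hle
  have hnoeth : IsNoetherianRing A :=
    IsLocalization.isNoetherianRing (RingHom.ker (evalZero q F)).primeCompl A inferInstance
  have hunit : ∀ w : CoordRing q F, evalZero q F w ≠ 0 → IsUnit (algebraMap _ A w) := fun w hw =>
    IsLocalization.map_units A (⟨w, hw⟩ : (RingHom.ker (evalZero q F)).primeCompl)
  have hmax : IsLocalRing.maximalIdeal A = Ideal.span {algebraMap _ A (xR q F)} := by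
    rw [← Localization.AtPrime.map_eq_maximalIdeal]
    refine le_antisymm (Ideal.map_le_iff_le_comap.2 fun w hw => ?_) ?_
    · obtain ⟨z, hz⟩ := xR_dvd_of_evalZero q F hw
      have h1 := hunit _ (by rw [evalZero_unit]; exact one_ne_zero)
      rw [Ideal.mem_comap, Ideal.mem_span_singleton]
      rw [← h1.dvd_mul_right, ← map_mul, hz, map_mul]
      exact dvd_mul_right _ _
    · rw [Ideal.span_singleton_le_iff_mem]
      exact Ideal.mem_map_of_mem _ (evalZero_xR q F)
  have hx0 : algebraMap _ A (xR q F) ≠ 0 := fun h =>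
    xR_ne_zero q F (hinj (by rw [h, map_zero]))
  have hfield : ¬ IsField A := by
    rw [IsLocalRing.isField_iff_maximalIdeal_eq, hmax, Ideal.span_singleton_eq_bot]
    exact hx0
  have hdvr : IsDiscreteValuationRing A :=
    ((IsDiscreteValuationRing.TFAE A hfield).out 0 4 :
      IsDiscreteValuationRing A ↔ (IsLocalRing.maximalIdeal A).IsPrincipal).2 ⟨_, hmax⟩
  have hirr : Irreducible (algebraMap _ A (xR q F)) :=
    (IsDiscreteValuationRing.irreducible_iff_uniformizer _).2 hmax
  obtain ⟨k, e, he⟩ := IsDiscreteValuationRing.eq_unit_mul_pow_irreducible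
    (x := algebraMap _ A u) (fun h => hu (hinj (by rw [h, map_zero]))) hirr
  obtain ⟨a, b, hab⟩ := IsLocalization.exists_mk'_eq (RingHom.ker (evalZero q F)).primeCompl
    (e : A)
  have hb : evalZero q F b ≠ 0 := b.2
  have h1 : algebraMap _ A a = e * algebraMap _ A (b : CoordRing q F) := by
    rw [← hab, IsLocalization.mk'_spec]
  refine ⟨k, a, b, ?_, hb, hinj ?_⟩
  · intro ha
    have h2 : IsUnit (algebraMap _ A a) := by rw [h1]; exact e.isUnit.mul (hunit _ hb)
    exact (IsLocalization.AtPrime.isUnit_to_map_iff A (RingHom.ker (evalZero q F)) a).1 h2 ha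
  · rw [map_mul, map_mul, map_pow, h1, he]
    ring

end Valuation

section Chart

variable {q F}
variable [hq : Fact (IsPrimePow q)] {K : Type*} [Field K] [Algebra F K]
  (φ : CoordRing q F →ₐ[F] K)

theorem chart_ne_zero (hφ : Function.Injective φ) {v : CoordRing q F} (hv : evalZero q F v ≠ 0) : φ v ≠ 0 := by
  intro h
  have : v = 0 := hφ (by rw [h, map_zero])
  rw [this, map_zero] at hv
  exact hv rfl

variable (hφ : Function.Injective φ) (hfrac : ∀ f : K, ∃ u v, φ v ≠ 0 ∧ f = φ u / φ v)

/-- Let `φ` be an embedding of the coordinate ring into a field `K` which is the fraction field of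
the image. The local ring of the point of this chart with coordinates `(0, 0)` consists of the
`φ u / φ v` with `v` not vanishing at the origin. -/
def chartRing : ValuationSubring K where
  carrier := {f | ∃ u v, evalZero q F v ≠ 0 ∧ f = φ u / φ v}
  mul_mem' := by
    rintro _ _ ⟨u, v, hv, rfl⟩ ⟨u', v', hv', rfl⟩
    exact ⟨u * u', v * v', by rw [map_mul]; exact mul_ne_zero hv hv',
      by rw [map_mul, map_mul, div_mul_div_comm]⟩
  one_mem' := ⟨1, 1, by rw [map_one]; exact one_ne_zero, by simp⟩
  add_mem' := by
    rintro _ _ ⟨u, v, hv, rfl⟩ ⟨u', v', hv', rfl⟩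
    refine ⟨u * v' + v * u', v * v', by rw [map_mul]; exact mul_ne_zero hv hv', ?_⟩
    rw [div_add_div _ _ (chart_ne_zero φ hφ hv) (chart_ne_zero φ hφ hv')]
    simp only [map_mul, map_add]
  zero_mem' := ⟨0, 1, by rw [map_one]; exact one_ne_zero, by simp⟩
  neg_mem' := by
    rintro _ ⟨u, v, hv, rfl⟩
    exact ⟨-u, v, hv, by rw [map_neg, neg_div]⟩
  mem_or_inv_mem' := by
    intro f
    obtain ⟨u, v, hv, rfl⟩ := hfrac f
    have hv0 : v ≠ 0 := by rintro rfl; exact hv (map_zero φ)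
    by_cases hu0 : u = 0
    · exact Or.inl ⟨0, 1, by rw [map_one]; exact one_ne_zero, by simp [hu0]⟩
    obtain ⟨k, a, b, ha, hb, h1⟩ := exists_eq_pow_mul q F hu0
    obtain ⟨l, c, d, hc, hd, h2⟩ := exists_eq_pow_mul q F hv0
    have hu : φ u ≠ 0 := fun h => hu0 (hφ (by rw [h, map_zero]))
    have hb' := chart_ne_zero φ hφ hb
    have hc' := chart_ne_zero φ hφ hc
    have hd' := chart_ne_zero φ hφ hd
    have ha' := chart_ne_zero φ hφ ha
    have h1' := congrArg φ h1
    have h2' := congrArg φ h2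
    rw [map_mul, map_mul, map_pow] at h1' h2'
    have hx : φ (xR q F) ≠ 0 := fun h => xR_ne_zero q F (hφ (by rw [h, map_zero]))
    rcases le_total l k with hlk | hlk
    · obtain ⟨m, rfl⟩ := Nat.exists_eq_add_of_le hlk
      refine Or.inl ⟨xR q F ^ m * a * d, b * c, by rw [map_mul]; exact mul_ne_zero hb hc, ?_⟩
      rw [div_eq_div_iff hv (by rw [map_mul]; exact mul_ne_zero hb' hc')]
      simp only [map_mul, map_pow]
      refine mul_left_cancel₀ (mul_ne_zero (pow_ne_zero l hx) hd') ?_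
      rw [pow_add] at h1'
      linear_combination φ c * φ (xR q F) ^ l * φ d * h1' -
        φ (xR q F) ^ m * φ a * φ d * φ (xR q F) ^ l * h2'
    · obtain ⟨m, rfl⟩ := Nat.exists_eq_add_of_le hlk
      refine Or.inr ⟨xR q F ^ m * c * b, d * a, by rw [map_mul]; exact mul_ne_zero hd ha, ?_⟩
      rw [inv_div, div_eq_div_iff hu (by rw [map_mul]; exact mul_ne_zero hd' ha')]
      simp only [map_mul, map_pow]
      refine mul_left_cancel₀ (mul_ne_zero (pow_ne_zero k hx) hb') ?_
      rw [pow_add] at h2'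
      linear_combination φ a * φ (xR q F) ^ k * φ b * h2' -
        φ (xR q F) ^ m * φ c * φ b * φ (xR q F) ^ k * h1'

theorem mem_chartRing {f : K} :
    f ∈ chartRing φ hφ hfrac ↔ ∃ u v, evalZero q F v ≠ 0 ∧ f = φ u / φ v := Iff.rfl

theorem chartRing_discrete : IsDiscreteValuationRing (chartRing φ hφ hfrac) := by
  have hx : φ (xR q F) ≠ 0 := fun h => xR_ne_zero q F (hφ (by rw [h, map_zero]))
  have hone : evalZero q F (1 : CoordRing q F) ≠ 0 := by rw [map_one]; exact one_ne_zero
  let p : chartRing φ hφ hfrac := ⟨φ (xR q F), xR q F, 1, hone, by simp⟩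
  have key : ∀ u v : CoordRing q F, evalZero q F v ≠ 0 → ∀ z : chartRing φ hφ hfrac,
      φ u / φ v = φ (xR q F) * z → evalZero q F u = 0 := by
    rintro u v hv ⟨_, c, d, hd, rfl⟩ h
    have hd' := chart_ne_zero φ hφ hd
    have hv' := chart_ne_zero φ hφ hv
    change φ u / φ v = φ (xR q F) * (φ c / φ d) at h
    rw [← mul_div_assoc, div_eq_div_iff hv' hd', ← map_mul, ← map_mul, ← map_mul] at h
    have h1 := congrArg (evalZero q F) (hφ h)
    rw [map_mul, map_mul, map_mul, evalZero_xR, zero_mul, zero_mul] at h1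
    exact (mul_eq_zero.1 h1).resolve_right hd
  have hprime : Prime p := by
    refine ⟨fun h => hx (congrArg Subtype.val h), fun h => ?_, ?_⟩
    · obtain ⟨z, hz⟩ := h.exists_right_inv
      refine hone (key 1 1 hone z ?_)
      have := congrArg Subtype.val hz
      simpa using this.symm
    · rintro ⟨_, a, b, hb, rfl⟩ ⟨_, c, d, hd, rfl⟩ ⟨z, hz⟩
      have h1 := key (a * c) (b * d) (by rw [map_mul]; exact mul_ne_zero hb hd) z (by
        have := congrArg Subtype.val hz
        rw [map_mul, map_mul, ← div_mul_div_comm]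
        exact this)
      have div : ∀ u v : CoordRing q F, ∀ hv : evalZero q F v ≠ 0, evalZero q F u = 0 →
          p ∣ (⟨φ u / φ v, u, v, hv, rfl⟩ : chartRing φ hφ hfrac) := by
        intro u v hv hu
        obtain ⟨w, hw⟩ := xR_dvd_of_evalZero q F hu
        have hun : evalZero q F ((yR q F) ^ (q - 1) + 1) ≠ 0 := by
          rw [evalZero_unit]; exact one_ne_zero
        have hmul : evalZero q F (v * ((yR q F) ^ (q - 1) + 1)) ≠ 0 := by
          rw [map_mul]; exact mul_ne_zero hv hun
        refine ⟨⟨φ w / φ (v * ((yR q F) ^ (q - 1) + 1)), w, _, hmul, rfl⟩, Subtype.ext ?_⟩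
        change φ u / φ v = φ (xR q F) * (φ w / φ (v * ((yR q F) ^ (q - 1) + 1)))
        rw [← mul_div_assoc, ← map_mul, ← hw, map_mul, map_mul,
          mul_div_mul_right _ _ (chart_ne_zero φ hφ hun)]
      rw [map_mul] at h1
      rcases mul_eq_zero.1 h1 with h | h
      · exact Or.inl (div a b hb h)
      · exact Or.inr (div c d hd h)
  refine IsDiscreteValuationRing.ofHasUnitMulPowIrreducibleFactorization
    ⟨p, hprime.irreducible, ?_⟩
  rintro ⟨_, u, v, hv, rfl⟩ hne
  have hu0 : u ≠ 0 := by
    rintro rfl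
    exact hne (Subtype.ext (by simp))
  obtain ⟨k, a, b, ha, hb, h1⟩ := exists_eq_pow_mul q F hu0
  have ha' := chart_ne_zero φ hφ ha
  have hb' := chart_ne_zero φ hφ hb
  have hv' := chart_ne_zero φ hφ hv
  have hbv : evalZero q F (b * v) ≠ 0 := by rw [map_mul]; exact mul_ne_zero hb hv
  have h1' := congrArg φ h1
  rw [map_mul, map_mul, map_pow] at h1'
  refine ⟨k, ⟨⟨⟨φ a / φ (b * v), a, _, hbv, rfl⟩, ⟨φ (b * v) / φ a, _, a, ha, rfl⟩, ?_, ?_⟩, ?_⟩⟩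
  · refine Subtype.ext ?_
    change φ a / φ (b * v) * (φ (b * v) / φ a) = 1
    rw [div_mul_div_cancel₀ (chart_ne_zero φ hφ hbv), div_self ha']
  · refine Subtype.ext ?_
    change φ (b * v) / φ a * (φ a / φ (b * v)) = 1
    rw [div_mul_div_cancel₀ ha', div_self (chart_ne_zero φ hφ hbv)]
  · refine Subtype.ext ?_
    change φ (xR q F) ^ k * (φ a / φ (b * v)) = φ u / φ v
    rw [← mul_div_assoc, ← h1', map_mul, mul_comm (φ u), mul_div_mul_left _ _ hb']

/-- The point of the chart `φ` with coordinates `(0, 0)`. -/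
def chartOrigin : Place F K where
  ring := chartRing φ hφ hfrac
  algebraMap_mem := fun c => ⟨algebraMap F _ c, 1, by rw [map_one]; exact one_ne_zero, by simp⟩
  discrete := chartRing_discrete φ hφ hfrac

end Chart

section Points

variable [hq : Fact (IsPrimePow q)]

/-- The rational function `x`. -/
def xK : FunField q F := algebraMap (CoordRing q F) (FunField q F) (xR q F)

/-- The rational function `y`. -/
def yK : FunField q F := algebraMap (CoordRing q F) (FunField q F) (yR q F)

theorem xK_pow : (xK q F) ^ (q + 1) = (yK q F) ^ q + yK q F := by
  rw [xK, yK, ← map_pow, ← map_pow, ← map_add, xR_pow]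

theorem aeval_yK (p : F[X]) :
    aeval (yK q F) p = algebraMap _ (FunField q F) (AdjoinRoot.of (curvePoly q F) p) := by
  have : aeval (yK q F) = ((IsScalarTower.toAlgHom F (CoordRing q F) (FunField q F)).comp
      (IsScalarTower.toAlgHom F F[X] (CoordRing q F))) :=
    Polynomial.algHom_ext (by rw [aeval_X]; rfl)
  rw [this]
  rfl

theorem yK_transcendental : Transcendental F (yK q F) := by
  rw [transcendental_iff]
  intro p hp
  rw [aeval_yK] at hp
  exact ofY_injective q F (by
    rw [map_zero]
    exact IsFractionRing.injective (CoordRing q F) (FunField q F) (by rw [hp, map_zero]))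

theorem yK_ne_zero : yK q F ≠ 0 := fun h =>
  yK_transcendental q F (h ▸ isAlgebraic_zero)

/-- The functions `s = x / y` and `t = 1 / y` again satisfy `t ^ q + t = s ^ (q + 1)`. They are the
affine coordinates `X / Y` and `Z / Y` of the projective curve `Y ^ q Z + Y Z ^ q = X ^ (q + 1)` on
the chart `Y ≠ 0`. The point at infinity `(0 : 1 : 0)` has coordinates `s = t = 0`. -/
def inftyChart : CoordRing q F →ₐ[F] FunField q F :=
  subst (xK q F / yK q F) (1 / yK q F) (by
    have h := yK_ne_zero q F
    rw [div_pow, div_pow, xK_pow, one_pow, eq_div_iff (pow_ne_zero _ h), pow_succ]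
    field_simp
    ring)

theorem inftyChart_injective : Function.Injective (inftyChart q F) := by
  rw [← RingHom.coe_coe, RingHom.injective_iff_ker_eq_bot]
  have : Module.Finite F[X] (CoordRing q F) := (curvePoly_monic q F).finite_adjoinRoot
  have : (RingHom.ker (inftyChart q F : CoordRing q F →+* FunField q F)).IsPrime :=
    RingHom.ker_isPrime _
  refine Ideal.eq_bot_of_comap_eq_bot (R := F[X]) ((Submodule.eq_bot_iff _).2 fun p hp => ?_)
  have h1 : inftyChart q F (AdjoinRoot.of (curvePoly q F) p) = 0 := hp
  rw [inftyChart, subst, AdjoinRoot.liftAlgHom_of] at h1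
  by_contra hne
  have h2 : IsAlgebraic F (1 / yK q F) := ⟨p, hne, h1⟩
  rw [one_div] at h2
  exact yK_transcendental q F (by simpa using h2.inv)

theorem inftyChart_frac (f : FunField q F) :
    ∃ u v, inftyChart q F v ≠ 0 ∧ f = inftyChart q F u / inftyChart q F v := by
  let σ : FunField q F →+* FunField q F := IsFractionRing.lift
    (g := (inftyChart q F : CoordRing q F →+* FunField q F)) (inftyChart_injective q F)
  have hσ : ∀ u, σ (algebraMap (CoordRing q F) _ u) = inftyChart q F u := fun u =>
    IsFractionRing.lift_algebraMap (inftyChart_injective q F) u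
  have hσx : σ (xK q F) = xK q F / yK q F := by rw [xK, hσ]; simp [inftyChart, xK]
  have hσy : σ (yK q F) = 1 / yK q F := by rw [yK, hσ]; simp [inftyChart, yK]
  have hσF : ∀ c : F, σ (algebraMap F _ c) = algebraMap F _ c := fun c => by
    rw [IsScalarTower.algebraMap_apply F (CoordRing q F) (FunField q F), hσ, AlgHom.commutes,
      IsScalarTower.algebraMap_apply F (CoordRing q F) (FunField q F)]
  let σ' : FunField q F →ₐ[F] FunField q F := { σ with commutes' := hσF }
  have hhom : σ'.comp (inftyChart q F) =
      IsScalarTower.toAlgHom F (CoordRing q F) (FunField q F) := by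
    have h0 := yK_ne_zero q F
    refine hom_ext ?_ ?_
    · change σ (inftyChart q F (xR q F)) = xK q F
      rw [inftyChart, subst_xR, map_div₀, hσx, hσy]
      field_simp
    · change σ (inftyChart q F (yR q F)) = yK q F
      rw [inftyChart, subst_yR, map_div₀, hσy, map_one, one_div_one_div]
  have hinv : ∀ u, σ (inftyChart q F u) = algebraMap (CoordRing q F) _ u := fun u =>
    DFunLike.congr_fun hhom u
  obtain ⟨u, v, hv, huv⟩ := IsFractionRing.div_surjective (A := CoordRing q F) (σ f)
  have hv0 : inftyChart q F v ≠ 0 := fun h => nonZeroDivisors.ne_zero hv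
    (inftyChart_injective q F (by rw [h, map_zero]))
  refine ⟨u, v, hv0, σ.injective ?_⟩
  rw [map_div₀, hinv, hinv, huv]

/-- The origin `P_0` of the Hermitian curve. -/
def pZero : Place F (FunField q F) :=
  chartOrigin (IsScalarTower.toAlgHom F (CoordRing q F) (FunField q F))
    (IsFractionRing.injective (CoordRing q F) (FunField q F)) (fun f => by
      obtain ⟨u, v, hv, huv⟩ := IsFractionRing.div_surjective (A := CoordRing q F) f
      exact ⟨u, v, fun h => nonZeroDivisors.ne_zero hv
        (IsFractionRing.injective (CoordRing q F) (FunField q F) (by rw [map_zero]; exact h)),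
        huv.symm⟩)

/-- The point at infinity `P_∞` of the Hermitian curve. -/
def pInfty : Place F (FunField q F) :=
  chartOrigin (inftyChart q F) (inftyChart_injective q F) (inftyChart_frac q F)

/-- The divisor `G = a P_∞ + b P_0`. -/
def twoPoint (a b : ℤ) : Place F (FunField q F) →₀ ℤ :=
  Finsupp.single (pInfty q F) a + Finsupp.single (pZero q F) b

/-- The set `M_{P_0}(a, b)` of pairs `(f, g)` of rational functions. -/
def pairsZero (a b : ℤ) : Set (FunField q F × FunField q F) :=
  {p | p.1 * p.2 ∈ riemannRoch (twoPoint q F a b) \ riemannRoch (twoPoint q F a (b - 1)) ∧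
    p.1 ∈ riemannRoch (twoPoint q F a b) ∧
    p.2 ∈ riemannRoch (twoPoint q F 0 (a + b))}

/-- The multiplicity `m_{P_0}(a, b)`. -/
def multZero (a b : ℤ) : ℕ :=
  Set.ncard {j : ℤ | -a ≤ j ∧ j ≤ b + 1 ∧
    ∃ p ∈ pairsZero q F a (b + 1), (pZero q F).ord p.1 = -j}

end Points

end Hermitian

end

/-! This is the order bound. Write `G` for the divisor `a P_∞ + b P_0`, `Q = P_0` and `H = G + Q`.
The functional `f ↦ ∑ cᵢ f(Pᵢ)` kills `L(G)` but not `L(H)`. Since `Q` is rational, `L(H)/L(G)` has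
dimension at most one, so the functional is nonzero on every element of `L(H)` whose order at `Q` is
exactly `-H(Q)` (`dotProduct_value_ne_zero`).

Choose one pair `(f_j, g_j)` for each counted `j`. The orders of the `f_j` at `Q` are distinct, so a
nonzero combination `h` of them has the order of some `f_j` there (`exists_ord_sum_eq`). Away from
`Q`, `h` obeys the bound of `L(H)` and `g_j` has no poles. Hence `h g_j` lies in `L(H)` with the
extremal order at `Q`, and the functional does not vanish on it. So `h` cannot vanish at every `Pᵢ`
with `cᵢ ≠ 0`. The vectors of values of the `f_j` on the support of `c` are therefore independent,
and there are at most as many as the weight of `c` (`card_le_hammingNorm`).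

Of the curve itself, only the rationality of `P_0` and `P_0 ≠ P_∞` enter. -/

namespace FunctionField

variable {F K : Type*} [Field F] [Field K] [Algebra F K]

/-! ### Orders and values at a place -/

namespace Place

variable (P : Place F K)

/-- Here `t` is the valuation of a uniformizer. The formula transfers facts about the valuation to
`ord`, reversing inequalities because `t < 1`. -/
theorem exists_valuation_eq_zpow_ord :
    ∃ t : P.ring.ValueGroup, 0 < t ∧ t < 1 ∧ ∀ f : K, f ≠ 0 → P.ring.valuation f = t ^ P.ord f := by
  obtain ⟨ϖ, hϖ⟩ := IsDiscreteValuationRing.exists_irreducible P.ring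
  have key : ∀ f : P.ring, f ≠ 0 →
      P.ring.valuation (f : K) = P.ring.valuation (ϖ : K) ^ P.ordNat f := by
    intro f hf
    obtain ⟨n, u, rfl⟩ := IsDiscreteValuationRing.eq_unit_mul_pow_irreducible hf hϖ
    rw [ordNat, IsDiscreteValuationRing.addVal_def' u hϖ, ENat.toNat_natCast]
    push_cast
    rw [map_mul, map_pow, P.ring.valuation_unit u, one_mul]
  refine ⟨P.ring.valuation ϖ, ?_, ?_, fun f hf => ?_⟩
  · rw [zero_lt_iff, Ne, map_eq_zero]
    exact fun h => hϖ.ne_zero (Subtype.ext h)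
  · exact (P.ring.valuation_lt_one_iff ϖ).1 ((IsLocalRing.mem_maximalIdeal _).2 hϖ.not_isUnit)
  · rw [ord]
    split_ifs with h
    · rw [zpow_natCast]
      exact key ⟨f, h⟩ fun h0 => hf (congrArg Subtype.val h0)
    · have h1 := key ⟨f⁻¹, (P.ring.mem_or_inv_mem f).resolve_left h⟩
        fun h0 => inv_ne_zero hf (congrArg Subtype.val h0)
      rw [zpow_neg, zpow_natCast, ← h1, map_inv₀, inv_inv]

variable {P}

theorem valuation_le_iff_ord {f g : K} (hf : f ≠ 0) (hg : g ≠ 0) :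
    P.ring.valuation f ≤ P.ring.valuation g ↔ P.ord g ≤ P.ord f := by
  obtain ⟨t, h0, h1, h⟩ := P.exists_valuation_eq_zpow_ord
  rw [h f hf, h g hg, zpow_le_zpow_iff_right_of_lt_one₀ h0 h1]

theorem valuation_lt_iff_ord {f g : K} (hf : f ≠ 0) (hg : g ≠ 0) :
    P.ring.valuation f < P.ring.valuation g ↔ P.ord g < P.ord f := by
  rw [← not_le, valuation_le_iff_ord hg hf, not_le]

theorem ord_eq_of_valuation_eq {f g : K} (hf : f ≠ 0) (hg : g ≠ 0)
    (h : P.ring.valuation f = P.ring.valuation g) : P.ord f = P.ord g :=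
  le_antisymm ((valuation_le_iff_ord hg hf).1 h.ge) ((valuation_le_iff_ord hf hg).1 h.le)

theorem ord_mul {f g : K} (hf : f ≠ 0) (hg : g ≠ 0) : P.ord (f * g) = P.ord f + P.ord g := by
  obtain ⟨t, h0, h1, h⟩ := P.exists_valuation_eq_zpow_ord
  apply zpow_right_injective₀ h0 h1.ne
  change t ^ _ = t ^ _
  rw [zpow_add₀ h0.ne', ← h f hf, ← h g hg, ← h _ (mul_ne_zero hf hg), map_mul]

theorem mem_ring_of_ord_nonneg {f : K} (h : f = 0 ∨ 0 ≤ P.ord f) : f ∈ P.ring := by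
  by_cases hf : f = 0
  · rw [hf]; exact P.ring.zero_mem
  obtain ⟨t, h0, h1, ht⟩ := P.exists_valuation_eq_zpow_ord
  rw [← P.ring.valuation_le_one_iff, ht f hf]
  have := zpow_right_anti₀ h0 h1.le (h.resolve_left hf)
  simpa using this

theorem min_ord_le_ord_add {f g : K} (hf : f ≠ 0) (hg : g ≠ 0) (hfg : f + g ≠ 0) :
    min (P.ord f) (P.ord g) ≤ P.ord (f + g) := by
  rcases le_total (P.ring.valuation f) (P.ring.valuation g) with h | h
  · exact min_le_of_right_le ((valuation_le_iff_ord hfg hg).1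
      ((P.ring.valuation.map_add f g).trans (max_le h le_rfl)))
  · exact min_le_of_left_le ((valuation_le_iff_ord hfg hf).1
      ((P.ring.valuation.map_add f g).trans (max_le le_rfl h)))

/-- Both `c` and `c⁻¹` lie in the local ring, so `c` is a unit there. -/
theorem valuation_algebraMap {c : F} (hc : c ≠ 0) :
    P.ring.valuation (algebraMap F K c) = 1 := by
  refine le_antisymm ((P.ring.valuation_le_one_iff _).2 (P.algebraMap_mem c)) ?_
  have h := (P.ring.valuation_le_one_iff _).2 (P.algebraMap_mem c⁻¹)
  rw [map_inv₀, map_inv₀] at h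
  refine (inv_le_one₀ ?_).1 h
  rw [zero_lt_iff, Ne, map_eq_zero, map_eq_zero]
  exact hc

theorem ord_algebraMap_mul {c : F} (hc : c ≠ 0) {f : K} (hf : f ≠ 0) :
    P.ord (algebraMap F K c * f) = P.ord f := by
  refine ord_eq_of_valuation_eq (mul_ne_zero (by simpa using hc) hf) hf ?_
  rw [map_mul, valuation_algebraMap hc, one_mul]

/-- Two candidate values differ by a constant in the maximal ideal, and a nonzero constant is a
unit. -/
theorem value_eq {f : K} {c : F} (h : f - algebraMap F K c ∈ P.ring.nonunits) :
    P.value f = c := by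
  have h1 : f - algebraMap F K (P.value f) ∈ P.ring.nonunits :=
    Classical.epsilon_spec (p := fun c : F => f - algebraMap F K c ∈ P.ring.nonunits) ⟨c, h⟩
  by_contra hne
  have h2 := sub_mem h h1
  rw [sub_sub_sub_cancel_left, ← map_sub, ValuationSubring.mem_nonunits_iff,
    valuation_algebraMap (sub_ne_zero.2 hne)] at h2
  exact lt_irrefl _ h2

theorem sub_value_mem_nonunits (hP : P.IsRational) {f : K} (hf : f ∈ P.ring) :
    f - algebraMap F K (P.value f) ∈ P.ring.nonunits :=
  Classical.epsilon_spec (p := fun c : F => f - algebraMap F K c ∈ P.ring.nonunits) (hP f hf)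

theorem mul_mem_nonunits {f g : K} (hf : f ∈ P.ring) (hg : g ∈ P.ring.nonunits) :
    f * g ∈ P.ring.nonunits := by
  rw [ValuationSubring.mem_nonunits_iff] at *
  rw [map_mul]
  exact mul_lt_one_of_nonneg_of_lt_one_right ((P.ring.valuation_le_one_iff f).2 hf) zero_le hg

theorem value_zero : P.value (0 : K) = 0 :=
  value_eq (by rw [map_zero, sub_zero]; exact zero_mem _)

theorem value_add (hP : P.IsRational) {f g : K} (hf : f ∈ P.ring) (hg : g ∈ P.ring) :
    P.value (f + g) = P.value f + P.value g := by
  apply value_eq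
  rw [map_add, add_sub_add_comm]
  exact add_mem (sub_value_mem_nonunits hP hf) (sub_value_mem_nonunits hP hg)

theorem value_mul (hP : P.IsRational) {f g : K} (hf : f ∈ P.ring) (hg : g ∈ P.ring) :
    P.value (f * g) = P.value f * P.value g := by
  apply value_eq
  -- `f g - f(P) g(P) = f (g - g(P)) + g(P) (f - f(P))`.
  have h := add_mem (mul_mem_nonunits hf (sub_value_mem_nonunits hP hg))
    (mul_mem_nonunits (P.algebraMap_mem (P.value g)) (sub_value_mem_nonunits hP hf))
  convert h using 1
  rw [map_mul]
  ring

theorem value_algebraMap (c : F) : P.value (algebraMap F K c) = c :=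
  value_eq (by rw [sub_self]; exact zero_mem _)

theorem value_sum (hP : P.IsRational) {ι : Type*} (s : Finset ι) (l : ι → F) (f : ι → K)
    (hf : ∀ j, f j ∈ P.ring) :
    P.value (∑ j ∈ s, algebraMap F K (l j) * f j) = ∑ j ∈ s, l j * P.value (f j) := by
  classical
  have hmem : ∀ j, algebraMap F K (l j) * f j ∈ P.ring := fun j =>
    P.ring.mul_mem _ _ (P.algebraMap_mem _) (hf j)
  induction s using Finset.induction_on with
  | empty => simp [value_zero]
  | insert i s hi ih =>
    rw [Finset.sum_insert hi, Finset.sum_insert hi,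
      value_add hP (hmem i) (sum_mem fun j _ => hmem j), ih,
      value_mul hP (P.algebraMap_mem _) (hf i), value_algebraMap]

end Place

/-! ### Riemann-Roch spaces and adding a rational point -/

theorem add_mem_riemannRoch {G : Place F K →₀ ℤ} {f g : K} (hf : f ∈ riemannRoch G)
    (hg : g ∈ riemannRoch G) : f + g ∈ riemannRoch G := by
  by_cases hf0 : f = 0
  · rwa [hf0, zero_add]
  by_cases hg0 : g = 0
  · rwa [hg0, add_zero]
  by_cases hfg : f + g = 0
  · exact Or.inl hfg
  refine Or.inr fun P => ?_
  have h1 := hf.resolve_left hf0 P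
  have h2 := hg.resolve_left hg0 P
  have h3 := Place.min_ord_le_ord_add (P := P) hf0 hg0 hfg
  rcases min_le_iff.1 h3 with h | h <;> omega

theorem algebraMap_mul_mem_riemannRoch {G : Place F K →₀ ℤ} (c : F) {f : K}
    (hf : f ∈ riemannRoch G) : algebraMap F K c * f ∈ riemannRoch G := by
  by_cases hf0 : f = 0
  · exact Or.inl (by rw [hf0, mul_zero])
  by_cases hc : c = 0
  · exact Or.inl (by rw [hc, map_zero, zero_mul])
  refine Or.inr fun P => ?_
  rw [Place.ord_algebraMap_mul hc hf0]
  exact hf.resolve_left hf0 P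

theorem sum_mem_riemannRoch {G : Place F K →₀ ℤ} {ι : Type*} (s : Finset ι) (l : ι → F) (f : ι → K)
    (hf : ∀ j, f j ∈ riemannRoch G) : ∑ j ∈ s, algebraMap F K (l j) * f j ∈ riemannRoch G := by
  classical
  induction s using Finset.induction_on with
  | empty => exact Or.inl Finset.sum_empty
  | insert i s hi ih =>
    rw [Finset.sum_insert hi]
    exact add_mem_riemannRoch (algebraMap_mul_mem_riemannRoch _ (hf i)) ih

theorem mem_ring_of_mem_riemannRoch {G : Place F K →₀ ℤ} {f : K} (hf : f ∈ riemannRoch G)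
    {P : Place F K} (hP : G P = 0) : f ∈ P.ring :=
  Place.mem_ring_of_ord_nonneg (hf.imp_right fun h => by simpa [hP] using h P)

/-- If the divisors `G` and `H` differ by the rational point `Q` and `v ∈ L(H) \ L(G)`, then every
`u ∈ L(H)` is congruent modulo `L(G)` to a scalar multiple of `v`. -/
theorem exists_sub_algebraMap_mul_mem_riemannRoch {G H : Place F K →₀ ℤ} {Q : Place F K}
    (hQ : Q.IsRational) (hGH : ∀ P, P ≠ Q → G P = H P) (hGQ : H Q = G Q + 1) {u v : K}
    (hu : u ∈ riemannRoch H) (hv : v ∈ riemannRoch H) (hv0 : v ≠ 0) (hvQ : Q.ord v = -H Q) :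
    ∃ s : F, u + algebraMap F K s * v ∈ riemannRoch G := by
  -- `v` has the largest pole order at `Q` that `L(H)` allows, so the quotient is regular there.
  have hw : u / v ∈ Q.ring := by
    rw [← ValuationSubring.valuation_le_one_iff, map_div₀]
    by_cases hu0 : u = 0
    · simp [hu0]
    rw [div_le_one₀ (by rw [zero_lt_iff, Ne, map_eq_zero]; exact hv0),
      Place.valuation_le_iff_ord hu0 hv0, hvQ]
    have := hu.resolve_left hu0 Q
    omega
  obtain ⟨s, hs⟩ := hQ _ hw
  -- With `s` the residue of `u / v` at `Q`, the function `u - s v = (u / v - s) v` has order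
  -- strictly above that of `v`. This gains the one unit by which `H` exceeds `G`.
  refine ⟨-s, ?_⟩
  have hmem : u + algebraMap F K (-s) * v ∈ riemannRoch H :=
    add_mem_riemannRoch hu (algebraMap_mul_mem_riemannRoch _ hv)
  by_cases h0 : u + algebraMap F K (-s) * v = 0
  · exact Or.inl h0
  refine Or.inr fun P => ?_
  by_cases hP : P = Q
  · subst hP
    have heq : u + algebraMap F K (-s) * v = (u / v - algebraMap F K s) * v := by
      rw [sub_mul, div_mul_cancel₀ _ hv0, map_neg, neg_mul, sub_eq_add_neg]
    have hlt : P.ring.valuation (u + algebraMap F K (-s) * v) < P.ring.valuation v := by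
      rw [heq, map_mul]
      exact mul_lt_of_lt_one_left (by rw [zero_lt_iff, Ne, map_eq_zero]; exact hv0)
        ((ValuationSubring.mem_nonunits_iff _).1 hs)
    rw [Place.valuation_lt_iff_ord h0 hv0] at hlt
    omega
  · rw [hGH P hP]
    exact hmem.resolve_left h0 P

/-- The two spaces differ only in the condition at `Q`, and only by one unit, so failing the
stricter condition forces equality in the weaker one. -/
theorem ord_eq_of_mem_riemannRoch_diff {G H : Place F K →₀ ℤ} {Q : Place F K}
    (hGH : ∀ P, P ≠ Q → G P = H P) (hGQ : H Q = G Q + 1) {v : K}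
    (hv : v ∈ riemannRoch H \ riemannRoch G) : v ≠ 0 ∧ Q.ord v = -H Q := by
  have hv0 : v ≠ 0 := fun h => hv.2 (Or.inl h)
  refine ⟨hv0, ?_⟩
  have h1 := hv.1.resolve_left hv0
  by_contra hne
  refine hv.2 (Or.inr fun P => ?_)
  by_cases hP : P = Q
  · subst hP
    have := h1 P
    omega
  · rw [hGH P hP]
    exact h1 P

/-! ### The order bound -/

/-- A functional `∑ cᵢ f(Pᵢ)` that vanishes on `L(G)` but not on `L(G + Q)` does not vanish on any
element of `L(G + Q)` with the maximal pole order at `Q`. -/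
theorem dotProduct_value_ne_zero {n : ℕ} {P : Fin n → Place F K} (hrat : ∀ i, (P i).IsRational)
    {G H : Place F K →₀ ℤ} {Q : Place F K} (hQ : Q.IsRational)
    (hGH : ∀ P, P ≠ Q → G P = H P) (hGQ : H Q = G Q + 1) (hH : ∀ i, H (P i) = 0) {c : Fin n → F}
    (horth : ∀ v ∈ agCode P G, c ⬝ᵥ v = 0) (hnorth : ¬ ∀ v ∈ agCode P H, c ⬝ᵥ v = 0)
    {v : K} (hv : v ∈ riemannRoch H) (hv0 : v ≠ 0) (hvQ : Q.ord v = -H Q) :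
    (c ⬝ᵥ fun i => (P i).value v) ≠ 0 := by
  intro h
  apply hnorth
  rintro _ ⟨u, hu, rfl⟩
  -- Modulo `L(G)`, `u` is a multiple of `v`; if the functional killed `v`, it would kill all of
  -- `L(H)`.
  obtain ⟨s, hs⟩ := exists_sub_algebraMap_mul_mem_riemannRoch hQ hGH hGQ hu hv hv0 hvQ
  have h1 := horth _ ⟨_, hs, rfl⟩
  have h2 : (fun i => (P i).value (u + algebraMap F K s * v)) =
      (fun i => (P i).value u) + s • fun i => (P i).value v := by
    funext i
    have hvi := mem_ring_of_mem_riemannRoch hv (hH i)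
    rw [Place.value_add (hrat i) (mem_ring_of_mem_riemannRoch hu (hH i))
      ((P i).ring.mul_mem _ _ ((P i).algebraMap_mem s) hvi),
      Place.value_mul (hrat i) ((P i).algebraMap_mem s) hvi, Place.value_algebraMap]
    rfl
  simp only [h2, dotProduct_add, dotProduct_smul, h, smul_zero, add_zero] at h1
  exact h1

/-- In a nonzero linear combination of functions with pairwise distinct orders at `Q`, some term
has the order of the sum. -/
theorem exists_ord_sum_eq (Q : Place F K) {ι : Type*} [Fintype ι] (f : ι → K) (hf : ∀ j, f j ≠ 0)
    (hord : Function.Injective fun j => Q.ord (f j)) (l : ι → F) (hl : l ≠ 0) :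
    ∃ j, ∑ i, algebraMap F K (l i) * f i ≠ 0 ∧
      Q.ord (∑ i, algebraMap F K (l i) * f i) = Q.ord (f j) := by
  classical
  obtain ⟨k, hk⟩ := Function.ne_iff.1 hl
  -- The term of least order among those with nonzero coefficient dominates strictly, the orders
  -- being distinct, so the ultrametric inequality becomes an equality.
  obtain ⟨j, hj, hmin⟩ := Finset.exists_min_image (Finset.univ.filter fun i => l i ≠ 0)
    (fun i => Q.ord (f i)) ⟨k, by simpa using hk⟩
  have hlj : l j ≠ 0 := (Finset.mem_filter.1 hj).2
  have hfj : Q.ring.valuation (f j) ≠ 0 := by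
    rw [Ne, map_eq_zero]; exact hf j
  have hterm : Q.ring.valuation (algebraMap F K (l j) * f j) = Q.ring.valuation (f j) := by
    rw [map_mul, Place.valuation_algebraMap hlj, one_mul]
  have hval : Q.ring.valuation (∑ i, algebraMap F K (l i) * f i) = Q.ring.valuation (f j) := by
    rw [← Finset.add_sum_erase _ _ (Finset.mem_univ j), ← hterm]
    refine Valuation.map_add_eq_of_lt_left _ ?_
    rw [hterm]
    refine Valuation.map_sum_lt _ hfj fun i hi => ?_
    by_cases hli : l i = 0
    · rw [hli, map_zero, zero_mul, map_zero, zero_lt_iff]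
      exact hfj
    · rw [map_mul, Place.valuation_algebraMap hli, one_mul,
        Place.valuation_lt_iff_ord (hf i) (hf j)]
      exact lt_of_le_of_ne (hmin i (by simpa using hli))
        fun h => Finset.ne_of_mem_erase hi (hord h.symm)
  have hne : ∑ i, algebraMap F K (l i) * f i ≠ 0 := by
    rw [← Q.ring.valuation.ne_zero_iff, hval]
    exact hfj
  exact ⟨j, hne, Place.ord_eq_of_valuation_eq hne (hf j) hval⟩

/-- The order bound: functions `f j` with distinct orders at `Q` that have partners `g j` such that
`f j * g j ∈ L(H) \ L(G)`, where `H = G + Q`, bound the weight of `c` from below. -/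
theorem card_le_hammingNorm [DecidableEq F] {n : ℕ} {P : Fin n → Place F K}
    (hrat : ∀ i, (P i).IsRational)
    {G H : Place F K →₀ ℤ} {Q : Place F K} (hQ : Q.IsRational)
    (hGH : ∀ P, P ≠ Q → G P = H P) (hGQ : H Q = G Q + 1) (hH : ∀ i, H (P i) = 0) {c : Fin n → F}
    (horth : ∀ v ∈ agCode P G, c ⬝ᵥ v = 0) (hnorth : ¬ ∀ v ∈ agCode P H, c ⬝ᵥ v = 0)
    {ι : Type*} [Fintype ι] (f g : ι → K) (hord : Function.Injective fun j => Q.ord (f j))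
    (hf : ∀ j, f j ∈ riemannRoch H) (hg : ∀ j, ∀ P, P ≠ Q → 0 ≤ P.ord (g j))
    (hgP : ∀ i, P i ≠ Q) (hfg : ∀ j, f j * g j ∈ riemannRoch H \ riemannRoch G) :
    Fintype.card ι ≤ hammingNorm c := by
  have hfg' := fun j => ord_eq_of_mem_riemannRoch_diff hGH hGQ (hfg j)
  have hf0 : ∀ j, f j ≠ 0 := fun j => left_ne_zero_of_mul (hfg' j).1
  have hg0 : ∀ j, g j ≠ 0 := fun j => right_ne_zero_of_mul (hfg' j).1
  have hfP : ∀ j i, f j ∈ (P i).ring := fun j i => mem_ring_of_mem_riemannRoch (hf j) (hH i)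
  -- Only the coordinates in the support of `c` are kept, so that the dimension of the ambient space
  -- is the weight of `c`.
  let w : ι → {i // c i ≠ 0} → F := fun j i => (P i).value (f j)
  have hw : LinearIndependent F w := by
    rw [Fintype.linearIndependent_iff]
    intro l hl
    by_contra hne
    push Not at hne
    obtain ⟨j, h0, hj⟩ := exists_ord_sum_eq Q f hf0 hord l (Function.ne_iff.2 hne)
    set h := ∑ i, algebraMap F K (l i) * f i with hh
    have hmem : h ∈ riemannRoch H := sum_mem_riemannRoch _ _ _ hf
    -- At `Q`, `h` has the order of `f j`, so `h * g j` has the extremal order of `f j * g j`.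
    have hQord : Q.ord (h * g j) = -H Q := by
      rw [Place.ord_mul h0 (hg0 j), hj, ← Place.ord_mul (hf0 j) (hg0 j), (hfg' j).2]
    have hmem' : h * g j ∈ riemannRoch H := by
      refine Or.inr fun R => ?_
      by_cases hR : R = Q
      · rw [hR, hQord, neg_add_cancel]
      · rw [Place.ord_mul h0 (hg0 j)]
        have h1 := hmem.resolve_left h0 R
        have h2 := hg j R hR
        omega
    refine dotProduct_value_ne_zero hrat hQ hGH hGQ hH horth hnorth hmem'
      (mul_ne_zero h0 (hg0 j)) hQord (Finset.sum_eq_zero fun i _ => ?_)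
    -- Each summand of the functional at `h * g j` vanishes: off the support because of `c i`, on it
    -- because the assumed relation says `h` is zero at `P i`.
    by_cases hci : c i = 0
    · rw [hci, zero_mul]
    have h3 : (P i).value h = 0 := by
      rw [hh, Place.value_sum (hrat i) _ _ _ fun j => hfP j i]
      simpa [w] using congrFun hl ⟨i, hci⟩
    beta_reduce
    rw [Place.value_mul (hrat i) (mem_ring_of_mem_riemannRoch hmem (hH i))
      (Place.mem_ring_of_ord_nonneg (Or.inr (hg j _ (hgP i)))), h3, zero_mul, mul_zero]
  have h := hw.fintype_card_le_finrank
  rw [Module.finrank_fintype_fun_eq_card, Fintype.card_subtype] at h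
  exact h

end FunctionField

/-! ### The points `P_0` and `P_∞` of the Hermitian curve -/

namespace Hermitian

open FunctionField

variable {q : ℕ} {F : Type*} [Field F] [hq : Fact (IsPrimePow q)]

section Chart

variable {K : Type*} [Field K] [Algebra F K] (φ : CoordRing q F →ₐ[F] K)
  (hφ : Function.Injective φ) (hfrac : ∀ f : K, ∃ u v, φ v ≠ 0 ∧ f = φ u / φ v)

/-- If `v / u` were some `u' / v'` in the local ring, then `v v' = u' u`; at the origin the right
side is zero and the left side is not. -/
theorem div_mem_nonunits_chartRing {u v : CoordRing q F} (hu : evalZero q F u = 0)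
    (hv : evalZero q F v ≠ 0) : φ u / φ v ∈ (chartRing φ hφ hfrac).nonunits := by
  rw [ValuationSubring.mem_nonunits_iff_or, or_iff_not_imp_left]
  rintro hne ⟨u', v', hv', h⟩
  rw [inv_div, div_eq_div_iff (fun h => hne (by rw [h, zero_div])) (chart_ne_zero φ hφ hv'),
    ← map_mul, ← map_mul] at h
  have h1 := congrArg (evalZero q F) (hφ h)
  rw [map_mul, map_mul, hu, mul_zero] at h1
  exact mul_ne_zero hv hv' h1

/-- The residue of `u / v` is `u(0,0) / v(0,0)`: subtracting it leaves a numerator that vanishes at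
the origin. -/
theorem chartOrigin_isRational : (chartOrigin φ hφ hfrac).IsRational := by
  rintro _ ⟨u, v, hv, rfl⟩
  refine ⟨evalZero q F u / evalZero q F v, ?_⟩
  have h := div_mem_nonunits_chartRing φ hφ hfrac
    (u := u - algebraMap F _ (evalZero q F u / evalZero q F v) * v) (v := v)
    (by rw [map_sub, map_mul, evalZero_algebraMap, div_mul_cancel₀ _ hv, sub_self]) hv
  rwa [map_sub, map_mul, AlgHom.commutes, sub_div,
    mul_div_cancel_right₀ _ (chart_ne_zero φ hφ hv)] at h

theorem chart_yR_mem_nonunits : φ (yR q F) ∈ (chartOrigin φ hφ hfrac).ring.nonunits := by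
  have h := div_mem_nonunits_chartRing φ hφ hfrac (evalZero_yR q F) (v := 1)
    (by rw [map_one]; exact one_ne_zero)
  rwa [map_one, div_one] at h

end Chart

variable (q F)

theorem pZero_isRational : (pZero q F).IsRational := chartOrigin_isRational _ _ _

/-- `y` vanishes at `P_0` and `1 / y` vanishes at `P_∞`; a single place cannot have both in its
maximal ideal. -/
theorem pZero_ne_pInfty : pZero q F ≠ pInfty q F := by
  intro h
  have h0 : yK q F ∈ (pZero q F).ring.nonunits := chart_yR_mem_nonunits _ _ _
  have h1 : inftyChart q F (yR q F) ∈ (pInfty q F).ring.nonunits := chart_yR_mem_nonunits _ _ _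
  rw [← h, inftyChart, subst_yR, one_div, ValuationSubring.inv_mem_nonunits_iff] at h1
  exact h1.elim (yK_ne_zero q F) fun h1 => h1 (ValuationSubring.nonunits_subset h0)

theorem twoPoint_pZero (a b : ℤ) : twoPoint q F a b (pZero q F) = b := by
  simp [twoPoint, Finsupp.single_eq_of_ne (pZero_ne_pInfty q F)]

/-- The right side is independent of `b`, so raising `b` changes the divisor only at `P_0`. -/
theorem twoPoint_of_ne (a b : ℤ) {P : Place F (FunField q F)} (h : P ≠ pZero q F) :
    twoPoint q F a b P = Finsupp.single (pInfty q F) a P := by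
  simp [twoPoint, Finsupp.single_eq_of_ne h]

end Hermitian

/-! ### Application to two-point codes -/

theorem theorem2p2 (q : ℕ) [Fact (IsPrimePow q)] (F : Type*) [Field F] [Fintype F] [DecidableEq F]
    (hF : Fintype.card F = q ^ 2)
    (n : ℕ) (P : Fin n → FunctionField.Place F (Hermitian.FunField q F))
    (hrat : ∀ i, (P i).IsRational) (hinj : Function.Injective P)
    (a b : ℤ)
    (hsupp : ∀ i, P i ∉ (Hermitian.twoPoint q F a b).support)
    (hsupp' : ∀ i, P i ∉ (Hermitian.twoPoint q F a (b + 1)).support)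
    (c : Fin n → F)
    (horth : ∀ v ∈ FunctionField.agCode P (Hermitian.twoPoint q F a b), c ⬝ᵥ v = 0)
    (hnorth : ¬ ∀ v ∈ FunctionField.agCode P (Hermitian.twoPoint q F a (b + 1)), c ⬝ᵥ v = 0) :
    Hermitian.multZero q F a b ≤ hammingNorm c := by
  classical
  -- The two divisors have coefficients `b` and `b + 1` at `P_0`, which are not both zero.
  have hP : ∀ i, P i ≠ Hermitian.pZero q F := by
    intro i h
    have h1 := Finsupp.notMem_support_iff.1 (hsupp i)
    have h2 := Finsupp.notMem_support_iff.1 (hsupp' i)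
    rw [h, Hermitian.twoPoint_pZero] at h1 h2
    omega
  rw [Hermitian.multZero]
  set J := {j : ℤ | -a ≤ j ∧ j ≤ b + 1 ∧
    ∃ p ∈ Hermitian.pairsZero q F a (b + 1), (Hermitian.pZero q F).ord p.1 = -j} with hJ
  have hfin : J.Finite := (Set.finite_Icc (-a) (b + 1)).subset fun j hj => ⟨hj.1, hj.2.1⟩
  have := hfin.fintype
  -- One pair per `j`; its first entry has order `-j`, so the orders are distinct.
  choose p hp hord using fun j : J => j.2.2.2
  rw [← Nat.card_coe_set_eq, Nat.card_eq_fintype_card]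
  refine FunctionField.card_le_hammingNorm hrat (Hermitian.pZero_isRational q F)
    (fun R hR => ?_) ?_ (fun i => Finsupp.notMem_support_iff.1 (hsupp' i)) horth hnorth
    (fun j => (p j).1) (fun j => (p j).2) (fun j k hjk => ?_) (fun j => (hp j).2.1)
    (fun j R hR => ?_) hP (fun j => ?_)
  · rw [Hermitian.twoPoint_of_ne _ _ _ _ hR, Hermitian.twoPoint_of_ne _ _ _ _ hR]
  · rw [Hermitian.twoPoint_pZero, Hermitian.twoPoint_pZero]
  · have h : (Hermitian.pZero q F).ord (p j).1 = (Hermitian.pZero q F).ord (p k).1 := hjk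
    rw [hord, hord, neg_inj] at h
    exact Subtype.ext h
  · rcases (hp j).2.2 with h | h
    -- A zero partner is excluded because zero belongs to the smaller space `L(G)`.
    · exact absurd (Or.inl (by rw [h, mul_zero])) (hp j).1.2
    -- The partner lies in `L((a + b + 1) P_0)`, whose divisor is zero at every `R ≠ P_0`, including
    -- `P_∞`.
    · have h1 := h R
      rwa [Hermitian.twoPoint_of_ne _ _ _ _ hR, Finsupp.single_zero, Finsupp.zero_apply,
        add_zero] at h1
  · have h := (hp j).1
    rwa [add_sub_cancel_right] at h
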